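/- Let $(X_n)_{n\ge 1}$ be independent identically distributed real random variables with $\mathbf{E}X_1^2<\infty$. Put $$Z_n=\frac{X_1+\dots+X_n}{\sqrt n}\quad(n\ge 1),\qquad f_1(t)=\mathbf{E}\,e^{itX_1}\quad(t\in\mathbb{R}).$$ If a random variable $X$ has an absolutely continuous density $p$ (that is, $p$ is absolutely continuous on every compact interval), its Fisher information is $I(X)=\int_{\{p>0\}}\frac{p'(x)^2}{p(x)}\,dx\in[0,\infty]$, where $p'$ is the Radon--Nikodym derivative of $p$; in all other cases $I(X)=+\infty$. The following assertions are equivalent: (a) for some $n_0\ge 1$, $Z_{n_0}$ has finite Fisher information, $I(Z_{n_0})<\infty$; (b) for some $n_0\ge 1$, $Z_{n_0}$ has a density of bounded total variation on $\mathbb{R}$; (c) for some $n_0\ge 1$, $Z_{n_0}$ has a continuously differentiable density $p_{n_0}$ such that $\int_{-\infty}^{+\infty}|p_{n_0}'(x)|\,dx<\infty$; (d) for some $\varepsilon>0$, $|f_1(t)|=O(t^{-\varepsilon})$ as $t\to+\infty$; (e) for some $\nu>0$, $\int_{-\infty}^{+\infty}|f_1(t)|^{\nu}\,|t|\,dt<\infty$.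 -/

import Mathlib

open MeasureTheory ProbabilityTheory Filter
open scoped ENNReal Topology

noncomputable section

/-- `p` is a (probability) density of the measure `μ` on the real line, with respect to
Lebesgue measure. -/
structure IsDensity (p : ℝ → ℝ) (μ : Measure ℝ) : Prop where
  measurable : Measurable p
  nonneg : ∀ x, 0 ≤ p x
  eq_withDensity : μ = volume.withDensity (fun x => ENNReal.ofReal (p x))

/-- Absolute continuity of a function on the real line: absolute continuity on every compact
interval. -/
def IsAbsCont (p : ℝ → ℝ) : Prop :=
  ∀ a b : ℝ, AbsolutelyContinuousOnInterval p a b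

/-- The integral of `p'(x)² / p(x)` over `{p > 0}`, as an extended nonnegative number. For an
absolutely continuous `p`, `deriv p` is the Radon-Nikodym derivative of `p`. -/
def fisherIntegral (p : ℝ → ℝ) : ℝ≥0∞ :=
  ∫⁻ x in {x | 0 < p x}, ENNReal.ofReal (deriv p x ^ 2 / p x)

/-- The Fisher information of a measure on the line: `fisherIntegral p` if the measure has an
absolutely continuous density `p` (which is then unique, see `fisherInfo_eq`), and `∞` (the infimum
over the empty family) otherwise. -/
def fisherInfo (μ : Measure ℝ) : ℝ≥0∞ :=
  ⨅ (p : ℝ → ℝ) (_ : IsDensity p μ) (_ : IsAbsCont p), fisherIntegral p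

/-- The normalized sum `Z_n = (X_1 + ... + X_n) / √n`; the sequence `X_1, X_2, ...` is indexed by
`ℕ`, so that `X 0` stands for `X_1`. -/
def normalizedSum {Ω : Type*} (X : ℕ → Ω → ℝ) (n : ℕ) (ω : Ω) : ℝ :=
  (∑ i ∈ Finset.range n, X i ω) / √(n : ℝ)

theorem IsAbsCont.continuous {p : ℝ → ℝ} (hp : IsAbsCont p) : Continuous p := by
  rw [continuous_iff_continuousAt]
  intro x
  have h := (hp (x - 1) (x + 1)).uniformContinuousOn.continuousOn
  refine h.continuousAt ?_
  rw [Set.uIcc_of_le (by linarith)]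
  exact Icc_mem_nhds (by linarith) (by linarith)

theorem fisherInfo_eq {μ : Measure ℝ} [IsFiniteMeasure μ] {p : ℝ → ℝ} (hp : IsDensity p μ)
    (hc : IsAbsCont p) : fisherInfo μ = fisherIntegral p := by
  refine le_antisymm (iInf_le_of_le p (iInf₂_le_of_le hp hc le_rfl)) ?_
  refine le_iInf fun q => le_iInf fun hq => le_iInf fun hqc => ?_
  have h : (fun x => ENNReal.ofReal (p x)) =ᵐ[volume] fun x => ENNReal.ofReal (q x) := by
    refine (withDensity_eq_iff_of_sigmaFinite hp.measurable.ennreal_ofReal.aemeasurable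
      hq.measurable.ennreal_ofReal.aemeasurable).1 ?_
    rw [← hp.eq_withDensity, ← hq.eq_withDensity]
  have h2 : p =ᵐ[volume] q := by
    filter_upwards [h] with x hx
    exact (ENNReal.ofReal_eq_ofReal_iff (hp.nonneg x) (hq.nonneg x)).1 hx
  rw [Continuous.ae_eq_iff_eq volume hc.continuous hqc.continuous] at h2
  rw [h2]

end

/-! Everything passes through the decay (d) of f₁, since the characteristic function of Z_n is
f₁(t/√n)ⁿ.

(a) and (c) each give (b): finite Fisher information forces p' ∈ L¹, because |p'| ≤ p'²/p + p, and
an absolutely continuous function with integrable derivative has bounded variation. (b) gives (d): a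
density of variation V has a characteristic function at most πV/t, and an n-th root turns this into
f₁(t) = O(t^(-1/n)). (d) gives (e) by a large power; conversely f₁ is Lipschitz, so a large value at
t persists on an interval and costs a definite amount of the integral.

(d) gives (a) and (c) with the same n. The second moment makes f₁ twice differentiable with bounded
derivatives. For large n, the functions tᵏf₁ⁿ (k ≤ 2) and their first two derivatives are
integrable, so Fourier inversion yields a density p with p' and p'' of size O(1/(1+x²))
(`exists_density_of_charFun_eq_pow`). Thus p' ∈ L¹, and p ≥ 0 gives p'² ≤ Cp/(1+x²)
(`sq_deriv_le_of_nonneg`), so the Fisher information is finite. -/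

/-! ### Fisher information and bounded variation -/

theorem IsAbsCont.boundedVariationOn {p : ℝ → ℝ} (hp : IsAbsCont p)
    (hi : Integrable (deriv p)) : BoundedVariationOn p Set.univ := by
  set g : ℝ → ℝ := fun x => ∫ y in Set.Iic x, |deriv p y| with hg
  have hdiff : ∀ x y, x ≤ y → |p y - p x| ≤ g y - g x := by
    intro x y hxy
    have h1 : g y - g x = ∫ z in x..y, |deriv p z| :=
      intervalIntegral.integral_Iic_sub_Iic hi.abs.integrableOn hi.abs.integrableOn
    rw [h1, ← (hp x y).integral_deriv_eq_sub]
    exact intervalIntegral.abs_integral_le_integral_abs hxy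
  have hg0 : ∀ x, 0 ≤ g x := fun x => integral_nonneg fun _ => abs_nonneg _
  have hg1 : ∀ x, g x ≤ ∫ y, |deriv p y| := fun x =>
    setIntegral_le_integral hi.abs (Eventually.of_forall fun _ => abs_nonneg _)
  refine ne_top_of_le_ne_top (ENNReal.ofReal_ne_top (r := ∫ y, |deriv p y|)) ?_
  refine iSup_le fun ⟨n, u, hu, _⟩ => ?_
  have hs : ∀ i, 0 ≤ g (u (i + 1)) - g (u i) := fun i =>
    (abs_nonneg _).trans (hdiff _ _ (hu i.le_succ))
  calc ∑ i ∈ Finset.range n, edist (p (u (i + 1))) (p (u i))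
      ≤ ∑ i ∈ Finset.range n, ENNReal.ofReal (g (u (i + 1)) - g (u i)) := by
        refine Finset.sum_le_sum fun i _ => ?_
        rw [edist_dist, Real.dist_eq]
        exact ENNReal.ofReal_le_ofReal (hdiff _ _ (hu i.le_succ))
    _ = ENNReal.ofReal (g (u n) - g (u 0)) := by
        rw [← ENNReal.ofReal_sum_of_nonneg fun i _ => hs i,
          Finset.sum_range_sub (fun i => g (u i))]
    _ ≤ _ := ENNReal.ofReal_le_ofReal (by linarith [hg0 (u 0), hg1 (u n)])

theorem isAbsCont_of_contDiff {p : ℝ → ℝ} (hp : ContDiff ℝ 1 p) : IsAbsCont p := fun _ _ => by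
  obtain ⟨K, hK⟩ := hp.contDiffOn.exists_lipschitzOnWith (by decide) (convex_Icc _ _) isCompact_Icc
  exact hK.absolutelyContinuousOnInterval

theorem IsDensity.lintegral_lt_top {p : ℝ → ℝ} {μ : Measure ℝ} [IsFiniteMeasure μ]
    (hp : IsDensity p μ) : ∫⁻ x, ENNReal.ofReal (p x) < ∞ := by
  have h : μ Set.univ < ∞ := measure_lt_top _ _
  rwa [hp.eq_withDensity, withDensity_apply _ MeasurableSet.univ, setLIntegral_univ] at h

theorem IsDensity.integrable {p : ℝ → ℝ} {μ : Measure ℝ} [IsFiniteMeasure μ]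
    (hp : IsDensity p μ) : Integrable p :=
  ⟨hp.measurable.aestronglyMeasurable,
    (hasFiniteIntegral_iff_ofReal (Eventually.of_forall hp.nonneg)).2 hp.lintegral_lt_top⟩

/-- Where p > 0, |p'| ≤ p'²/p + p; a zero of p is a minimum, so `deriv p` vanishes there. -/
theorem IsDensity.integrable_deriv {p : ℝ → ℝ} {μ : Measure ℝ} [IsFiniteMeasure μ]
    (hp : IsDensity p μ) (hI : fisherIntegral p < ∞) : Integrable (deriv p) := by
  refine ⟨(measurable_deriv p).aestronglyMeasurable, ?_⟩
  have hS : MeasurableSet {x | 0 < p x} := measurableSet_lt measurable_const hp.measurable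
  have hle : ∀ x, ‖deriv p x‖ₑ ≤
      {x | 0 < p x}.indicator (fun x => ENNReal.ofReal (deriv p x ^ 2 / p x)) x +
        ENNReal.ofReal (p x) := by
    intro x
    rcases (hp.nonneg x).eq_or_lt with h0 | h0
    · have hm : IsLocalMin p x := Eventually.of_forall fun y => by rw [← h0]; exact hp.nonneg y
      simp [hm.deriv_eq_zero]
    · rw [Set.indicator_of_mem (by exact h0), ← ENNReal.ofReal_add (by positivity) h0.le,
        Real.enorm_eq_ofReal_abs]
      refine ENNReal.ofReal_le_ofReal ?_
      rw [← sub_nonneg]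
      have : deriv p x ^ 2 / p x + p x - |deriv p x| =
          ((|deriv p x| - p x) ^ 2 + |deriv p x| * p x) / p x := by
        rw [← sq_abs (deriv p x)]; field_simp; ring
      rw [this]
      positivity
  refine (lintegral_mono hle).trans_lt ?_
  rw [lintegral_add_right _ hp.measurable.ennreal_ofReal, lintegral_indicator hS]
  exact ENNReal.add_lt_top.2 ⟨hI, hp.lintegral_lt_top⟩

/-! ### Decay of the characteristic function of a density of bounded variation -/

/-- A function of bounded variation is Lipschitz in `L¹` under translations. -/
theorem integral_abs_translate_sub_le {p : ℝ → ℝ} (hp : BoundedVariationOn p Set.univ)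
    (hi : Integrable p) {h : ℝ} (hh : 0 ≤ h) :
    ∫ x, |p (x + h) - p x| ≤ 2 * (eVariationOn p Set.univ).toReal * h := by
  set V := (eVariationOn p Set.univ).toReal
  set v := variationOnFromTo p Set.univ 0
  have hv : Monotone v := by
    rw [← monotoneOn_univ]
    exact variationOnFromTo.monotoneOn hp.locallyBoundedVariationOn (Set.mem_univ _)
  have hvi : ∀ a b, IntervalIntegrable v volume a b := fun a b => hv.intervalIntegrable
  have hvh : Monotone fun x => v (x + h) := fun x y hxy => hv (by linarith)
  have hvV : ∀ x, |v x| ≤ V := fun x => variationOnFromTo.abs_le_eVariationOn hp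
  have hint : Integrable fun x => |p (x + h) - p x| := ((hi.comp_add_right h).sub hi).abs
  refine le_of_tendsto (intervalIntegral_tendsto_integral hint tendsto_neg_atTop_atBot tendsto_id)
    ?_
  filter_upwards [eventually_ge_atTop 0] with R hR
  simp only [id]
  -- Increments of p are dominated by those of its variation function v. The integral of v(x+h) -
  -- v(x) collapses to two end intervals of length h, where |v| ≤ V.
  calc ∫ x in -R..R, |p (x + h) - p x|
      ≤ ∫ x in -R..R, (v (x + h) - v x) := by
        refine intervalIntegral.integral_mono_on (by linarith) hint.intervalIntegrable
          (hvh.intervalIntegrable.sub (hvi _ _)) fun x _ => ?_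
        exact variationOnFromTo.abs_sub_le_sub_of_le hp.locallyBoundedVariationOn
          (Set.mem_univ _) (Set.mem_univ _) (Set.mem_univ _) (by linarith)
    _ = (∫ x in R..R + h, v x) - ∫ x in -R..-R + h, v x := by
        rw [intervalIntegral.integral_sub hvh.intervalIntegrable (hvi _ _),
          intervalIntegral.integral_comp_add_right (fun x => v x),
          intervalIntegral.integral_interval_sub_interval_comm' (hvi _ _) (hvi _ _) (hvi _ _)]
    _ ≤ V * h + V * h := by
        have key : ∀ a, |∫ x in a..a + h, v x| ≤ V * h := fun a => by
          have := intervalIntegral.norm_integral_le_of_norm_le_const (a := a) (b := a + h)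
            (f := v) (C := V) fun x _ => hvV x
          simpa [abs_of_nonneg hh] using this
        linarith [(abs_le.1 (key R)).2, (abs_le.1 (key (-R))).1]
    _ = _ := by ring

theorem IsDensity.charFun_eq {p : ℝ → ℝ} {μ : Measure ℝ} (hp : IsDensity p μ) (t : ℝ) :
    charFun μ t = ∫ x : ℝ, Complex.exp (t * x * Complex.I) * p x := by
  rw [charFun_apply_real, hp.eq_withDensity, integral_withDensity_eq_integral_toReal_smul
    hp.measurable.ennreal_ofReal (by simp)]
  refine integral_congr_ae (Eventually.of_forall fun x => ?_)
  simp only [ENNReal.toReal_ofReal (hp.nonneg x), Complex.real_smul]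
  ring

theorem norm_exp_mul_mul_I (t x : ℝ) : ‖Complex.exp (t * x * Complex.I)‖ = 1 := by
  rw [← Complex.ofReal_mul]; exact Complex.norm_exp_ofReal_mul_I _

theorem integrable_exp_mul {p : ℝ → ℂ} (hp : Integrable p) (t : ℝ) :
    Integrable fun x : ℝ => Complex.exp (t * x * Complex.I) * p x :=
  hp.bdd_mul (c := 1) (Continuous.aestronglyMeasurable (by fun_prop))
    (Eventually.of_forall fun x => (norm_exp_mul_mul_I t x).le)

/-- A shift by the half period π/t flips the sign of e^(itx). Averaging the two expressions replaces
p by half the difference of p and its translate, which is small in L¹; no integration by parts is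
needed. -/
theorem IsDensity.norm_charFun_le {p : ℝ → ℝ} {μ : Measure ℝ} [IsFiniteMeasure μ]
    (hp : IsDensity p μ) (hV : BoundedVariationOn p Set.univ) {t : ℝ} (ht : 0 < t) :
    ‖charFun μ t‖ ≤ (eVariationOn p Set.univ).toReal * Real.pi / t := by
  have hi := hp.integrable
  have hi' : Integrable fun x : ℝ => Complex.exp (t * x * Complex.I) * (p x : ℂ) :=
    integrable_exp_mul hi.ofReal t
  have hi2 : Integrable fun x : ℝ =>
      Complex.exp (t * x * Complex.I) * (p (x + Real.pi / t) : ℂ) :=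
    integrable_exp_mul (hi.comp_add_right (Real.pi / t)).ofReal t
  have hshift : charFun μ t =
      -∫ x : ℝ, Complex.exp (t * x * Complex.I) * (p (x + Real.pi / t) : ℂ) := by
    rw [hp.charFun_eq, ← integral_add_right_eq_self _ (Real.pi / t), ← integral_neg]
    refine integral_congr_ae (Eventually.of_forall fun x => ?_)
    have ht' : (t : ℂ) ≠ 0 := by exact_mod_cast ht.ne'
    have : (t : ℂ) * ((x + Real.pi / t : ℝ) : ℂ) * Complex.I =
        t * x * Complex.I + Real.pi * Complex.I := by
      push_cast; field_simp
    simp only [this, Complex.exp_add, Complex.exp_pi_mul_I]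
    ring
  have h2 : 2 * charFun μ t =
      -∫ x : ℝ, Complex.exp (t * x * Complex.I) * ((p (x + Real.pi / t) - p x : ℝ) : ℂ) := by
    rw [two_mul]
    nth_rewrite 1 [hshift]
    rw [hp.charFun_eq, neg_add_eq_sub, ← integral_sub hi' hi2, ← integral_neg]
    refine integral_congr_ae (Eventually.of_forall fun x => ?_)
    simp only [Complex.ofReal_sub]
    ring
  have h3 : 2 * ‖charFun μ t‖ ≤ 2 * (eVariationOn p Set.univ).toReal * (Real.pi / t) := by
    calc 2 * ‖charFun μ t‖ = ‖2 * charFun μ t‖ := by simp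
      _ ≤ ∫ x, |p (x + Real.pi / t) - p x| := by
        rw [h2, norm_neg]
        refine (norm_integral_le_integral_norm _).trans_eq ?_
        refine integral_congr_ae (Eventually.of_forall fun x => ?_)
        simp only [norm_mul, norm_exp_mul_mul_I, one_mul, Complex.norm_real, Real.norm_eq_abs]
      _ ≤ _ := integral_abs_translate_sub_le hV hi (by positivity)
  rw [mul_div_assoc]
  linarith

/-! ### Polynomial decay versus integrability of powers -/

theorem norm_charFun_abs (μ : Measure ℝ) (t : ℝ) : ‖charFun μ |t|‖ = ‖charFun μ t‖ := by
  rcases abs_choice t with h | h <;> simp [h]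

theorem exists_norm_charFun_le_of_isBigO {μ : Measure ℝ} [IsProbabilityMeasure μ] {ε : ℝ}
    (hε : 0 < ε) (h : (fun t : ℝ => ‖charFun μ t‖) =O[atTop] (fun t : ℝ => t ^ (-ε))) :
    ∃ C : ℝ, 0 < C ∧ ∀ t : ℝ, ‖charFun μ t‖ ≤ C * (1 + |t|) ^ (-ε) := by
  obtain ⟨c, hc, hb⟩ := h.exists_pos
  obtain ⟨T, hT⟩ := eventually_atTop.1 hb.bound
  set S := max T 1
  have hS1 : 1 ≤ S := le_max_right _ _
  -- The first summand serves |t| ≥ S, where |t| ≥ (1+|t|)/2; the second makes the bound at least 1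
  -- for |t| ≤ S.
  refine ⟨c * 2 ^ ε + (1 + S) ^ ε, by positivity, fun t => ?_⟩
  have hpos : 0 < 1 + |t| := by positivity
  have e1 : 0 ≤ c * 2 ^ ε * (1 + |t|) ^ (-ε) := by positivity
  have e2 : 0 ≤ (1 + S) ^ ε * (1 + |t|) ^ (-ε) := by positivity
  rw [add_mul]
  rcases le_total S |t| with hle | hle
  · have ht1 : 1 ≤ |t| := hS1.trans hle
    have h0 : 0 < |t| := by linarith
    have := hT |t| ((le_max_left _ _).trans hle)
    rw [norm_norm, norm_charFun_abs, Real.norm_of_nonneg (by positivity)] at this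
    have h2 : |t| ^ (-ε) ≤ 2 ^ ε * (1 + |t|) ^ (-ε) := by
      calc |t| ^ (-ε) ≤ ((1 + |t|) / 2) ^ (-ε) :=
            Real.rpow_le_rpow_of_nonpos (by positivity) (by linarith) (by linarith)
        _ = 2 ^ ε * (1 + |t|) ^ (-ε) := by
            rw [Real.div_rpow hpos.le (by norm_num), Real.rpow_neg (by norm_num : (0:ℝ) ≤ 2),
              div_inv_eq_mul, mul_comm]
    have := this.trans (mul_le_mul_of_nonneg_left h2 hc.le)
    linarith
  · have h3 : 1 ≤ (1 + S) ^ ε * (1 + |t|) ^ (-ε) := by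
      rw [Real.rpow_neg hpos.le, ← div_eq_mul_inv, one_le_div (by positivity)]
      exact Real.rpow_le_rpow hpos.le (by linarith) hε.le
    have := norm_charFun_le_one (μ := μ) t
    linarith

theorem exists_integrable_rpow_charFun {μ : Measure ℝ} [IsProbabilityMeasure μ] {ε : ℝ}
    (hε : 0 < ε) (h : (fun t : ℝ => ‖charFun μ t‖) =O[atTop] (fun t : ℝ => t ^ (-ε))) :
    ∃ ν : ℝ, 0 < ν ∧ Integrable (fun t : ℝ => ‖charFun μ t‖ ^ ν * |t|) := by
  obtain ⟨C, hC, hb⟩ := exists_norm_charFun_le_of_isBigO hε h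
  -- This power decays with exponent -3, so -2 remains after the factor |t|.
  refine ⟨3 / ε, by positivity, ?_⟩
  have hI : Integrable fun t : ℝ => C ^ (3 / ε) * (1 + ‖t‖) ^ (-2 : ℝ) :=
    (integrable_one_add_norm (by simp)).const_mul _
  refine hI.mono' (by fun_prop) (Eventually.of_forall fun t => ?_)
  have hpos : 0 < 1 + |t| := by positivity
  rw [Real.norm_of_nonneg (by positivity), Real.norm_eq_abs]
  calc ‖charFun μ t‖ ^ (3 / ε) * |t|
      ≤ (C * (1 + |t|) ^ (-ε)) ^ (3 / ε) * (1 + |t|) := by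
        gcongr
        · exact hb t
        · linarith
    _ = C ^ (3 / ε) * (1 + |t|) ^ (-2 : ℝ) := by
        rw [Real.mul_rpow hC.le (by positivity), ← Real.rpow_mul hpos.le, mul_assoc]
        congr 1
        nth_rewrite 2 [← Real.rpow_one (1 + |t|)]
        rw [← Real.rpow_add hpos]
        congr 1
        field_simp
        norm_num

theorem norm_iteratedDeriv_charFun_le {μ : Measure ℝ} [IsFiniteMeasure μ] {n : ℕ}
    (h : MemLp id n μ) (t : ℝ) : ‖iteratedDeriv n (charFun μ) t‖ ≤ ∫ x, |x| ^ n ∂μ := by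
  rw [iteratedDeriv_charFun h, norm_mul, norm_pow, Complex.norm_I, one_pow, one_mul]
  refine (norm_integral_le_integral_norm _).trans_eq ?_
  refine integral_congr_ae (Eventually.of_forall fun x => ?_)
  simp only [norm_mul, norm_exp_mul_mul_I, norm_pow, Complex.norm_real, Real.norm_eq_abs, mul_one]

theorem exists_lipschitz_charFun {μ : Measure ℝ} [IsFiniteMeasure μ] (h : MemLp id 1 μ) :
    ∃ L : ℝ, 1 ≤ L ∧ ∀ s t : ℝ, ‖charFun μ s - charFun μ t‖ ≤ L * |s - t| := by
  -- The added 1 keeps L positive even when the first absolute moment is zero.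
  refine ⟨1 + ∫ x, |x| ^ 1 ∂μ, ?_, fun s t => ?_⟩
  · have : 0 ≤ ∫ x, |x| ^ 1 ∂μ := integral_nonneg fun _ => by positivity
    linarith
  · have hd : Differentiable ℝ (charFun μ) :=
      (contDiff_charFun (n := 1) (by simpa using h)).differentiable (by simp)
    refine (convex_univ (𝕜 := ℝ)).norm_image_sub_le_of_norm_deriv_le (fun x _ => hd x)
      (fun x _ => ?_) (Set.mem_univ t) (Set.mem_univ s)
    have := norm_iteratedDeriv_charFun_le (n := 1) (by simpa using h) x
    rw [iteratedDeriv_one] at this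
    linarith

/-- With δ = |f(t)|, the Lipschitz bound keeps |f| ≥ δ/2 on [t, t + δ/(2L)]. The integral is then at
least (δ/2)^ν · t · δ/(2L), whence δ^(ν+1) = O(1/t). -/
theorem exists_isBigO_of_integrable_rpow_charFun {μ : Measure ℝ} [IsProbabilityMeasure μ]
    (hm : MemLp id 1 μ) {ν : ℝ} (hν : 0 < ν)
    (h : Integrable (fun t : ℝ => ‖charFun μ t‖ ^ ν * |t|)) :
    ∃ ε : ℝ, 0 < ε ∧ (fun t : ℝ => ‖charFun μ t‖) =O[atTop] (fun t : ℝ => t ^ (-ε)) := by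
  obtain ⟨L, hL1, hL⟩ := exists_lipschitz_charFun hm
  have hL0 : 0 < L := by linarith
  set J := ∫ t : ℝ, ‖charFun μ t‖ ^ ν * |t|
  have hJ : 0 ≤ J := integral_nonneg fun _ => by positivity
  refine ⟨1 / (ν + 1), by positivity, ?_⟩
  refine Asymptotics.IsBigO.of_bound ((2 ^ (ν + 1) * L * J) ^ (1 / (ν + 1))) ?_
  filter_upwards [eventually_gt_atTop 0] with t ht
  rw [norm_norm, Real.norm_of_nonneg (by positivity), Real.rpow_neg ht.le,
    ← Real.inv_rpow ht.le, ← Real.mul_rpow (by positivity) (by positivity)]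
  set δ := ‖charFun μ t‖
  have hδ : 0 ≤ δ := norm_nonneg _
  have hlow : (δ / 2) ^ ν * t * (δ / (2 * L)) ≤ J := by
    have hle : ∀ s ∈ Set.Icc t (t + δ / (2 * L)), (δ / 2) ^ ν * t ≤ ‖charFun μ s‖ ^ ν * |s| := by
      intro s hs
      have h1 : ‖charFun μ t - charFun μ s‖ ≤ δ / 2 := by
        refine (hL t s).trans ?_
        rw [abs_sub_comm, abs_of_nonneg (by linarith [hs.1])]
        calc L * (s - t) ≤ L * (δ / (2 * L)) := by gcongr; linarith [hs.2]
          _ = δ / 2 := by field_simp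
      have h2 : δ / 2 ≤ ‖charFun μ s‖ := by
        have := norm_sub_norm_le (charFun μ t) (charFun μ s)
        linarith
      have h3 : t ≤ |s| := hs.1.trans (le_abs_self s)
      gcongr
    calc (δ / 2) ^ ν * t * (δ / (2 * L))
        = ∫ _ in Set.Icc t (t + δ / (2 * L)), (δ / 2) ^ ν * t := by
          rw [setIntegral_const, smul_eq_mul, Real.volume_real_Icc_of_le (by
            have : 0 ≤ δ / (2 * L) := by positivity
            linarith)]
          ring
      _ ≤ ∫ s in Set.Icc t (t + δ / (2 * L)), ‖charFun μ s‖ ^ ν * |s| :=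
          setIntegral_mono_on continuous_const.integrableOn_Icc h.integrableOn measurableSet_Icc hle
      _ ≤ J := setIntegral_le_integral h (Eventually.of_forall fun _ => by positivity)
  have hpow : δ ^ (ν + 1) ≤ 2 ^ (ν + 1) * L * J * t⁻¹ := by
    have e : (δ / 2) ^ ν * t * (δ / (2 * L)) = δ ^ (ν + 1) * t / (2 ^ (ν + 1) * L) := by
      rw [Real.div_rpow hδ (by norm_num), Real.rpow_add_one' hδ (by positivity),
        Real.rpow_add_one (by norm_num)]
      field_simp
    rw [e, div_le_iff₀ (by positivity)] at hlow
    rw [← div_eq_mul_inv, le_div_iff₀ ht]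
    linarith
  calc δ = (δ ^ (ν + 1)) ^ (1 / (ν + 1)) := by
        rw [← Real.rpow_mul hδ, mul_one_div_cancel (by positivity), Real.rpow_one]
    _ ≤ _ := Real.rpow_le_rpow (by positivity) hpow (by positivity)

/-! ### Quadratic decay of Fourier transforms -/

theorem norm_fourier_le_integral_norm (f : ℝ → ℂ) (x : ℝ) :
    ‖FourierTransform.fourier f x‖ ≤ ∫ v, ‖f v‖ := by
  rw [Real.fourier_real_eq]
  refine (norm_integral_le_integral_norm _).trans_eq ?_
  simp only [Circle.norm_smul]

/-- Two derivatives multiply the transform by (2πix)², so ‖F''‖₁ controls x²|F̂|, while ‖F‖₁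
controls |F̂|. -/
theorem exists_norm_fourier_le {F F' F'' : ℝ → ℂ} (h1 : ∀ x, HasDerivAt F (F' x) x)
    (h2 : ∀ x, HasDerivAt F' (F'' x) x) (i0 : Integrable F) (i1 : Integrable F')
    (i2 : Integrable F'') :
    ∃ C : ℝ, ∀ x : ℝ, ‖FourierTransform.fourier F x‖ ≤ C / (1 + x ^ 2) := by
  have d1 : deriv F = F' := funext fun x => (h1 x).deriv
  have d2 : deriv F' = F'' := funext fun x => (h2 x).deriv
  have f1 := Real.fourier_deriv i0 (fun x => (h1 x).differentiableAt) (d1 ▸ i1)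
  have f2 := Real.fourier_deriv i1 (fun x => (h2 x).differentiableAt) (d2 ▸ i2)
  rw [d1] at f1
  rw [d2, f1] at f2
  refine ⟨(∫ v, ‖F v‖) + ∫ v, ‖F'' v‖, fun x => ?_⟩
  rw [le_div_iff₀ (by positivity)]
  have b0 := norm_fourier_le_integral_norm F x
  have b2 := norm_fourier_le_integral_norm F'' x
  rw [f2] at b2
  simp only [norm_smul, norm_mul, Complex.norm_ofNat, Complex.norm_real, Complex.norm_I,
    Real.norm_eq_abs, abs_of_pos Real.pi_pos, mul_one] at b2
  set a := ‖FourierTransform.fourier F x‖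
  have ha : 0 ≤ a := norm_nonneg _
  have : x ^ 2 * a ≤ 2 * Real.pi * |x| * (2 * Real.pi * |x| * a) := by
    have e : 2 * Real.pi * |x| * (2 * Real.pi * |x| * a) = (2 * Real.pi) ^ 2 * (x ^ 2 * a) := by
      rw [← sq_abs x]; ring
    rw [e]
    have h1 : 1 ≤ (2 * Real.pi) ^ 2 := one_le_pow₀ (by linarith [Real.pi_gt_three])
    exact le_mul_of_one_le_left (by positivity) h1
  linarith

theorem norm_ofReal_pow_le {j : ℕ} (hj : j ≤ 2) (v : ℝ) : ‖(v : ℂ) ^ j‖ ≤ (1 + |v|) ^ 2 := by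
  rw [norm_pow, Complex.norm_real, Real.norm_eq_abs]
  calc |v| ^ j ≤ (1 + |v|) ^ j := by gcongr; linarith
    _ ≤ (1 + |v|) ^ 2 := pow_le_pow_right₀ (by linarith [abs_nonneg v]) hj

theorem integrable_of_norm_le_rpow {f : ℝ → ℂ} (hf : Continuous f) {C : ℝ}
    (h : ∀ v, ‖f v‖ ≤ C * (1 + |v|) ^ (-2 : ℝ)) : Integrable f :=
  ((integrable_one_add_norm (E := ℝ) (r := 2) (by simp)).const_mul C).mono'
    hf.aestronglyMeasurable (Eventually.of_forall h)

/-- Sufficiently high powers of a function with bounded derivatives and polynomial decay have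
Fourier transforms that are twice differentiable with quadratic decay. -/
theorem fourier_pow_mul_pow {G G' G'' : ℝ → ℂ} (h1 : ∀ x, HasDerivAt G (G' x) x)
    (h2 : ∀ x, HasDerivAt G' (G'' x) x) (hc : Continuous G'') {M C : ℝ}
    (b0 : ∀ x, ‖G x‖ ≤ 1) (b1 : ∀ x, ‖G' x‖ ≤ M) (b2 : ∀ x, ‖G'' x‖ ≤ M) {m : ℕ}
    (hm : ∀ x, ‖G x‖ ^ m ≤ C * (1 + |x|) ^ (-4 : ℝ)) {k : ℕ} (hk : k ≤ 2) :
    Integrable (fun v : ℝ => (v : ℂ) ^ k * G v ^ (m + 2)) ∧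
    ∃ D : ℝ, ∀ x : ℝ,
      ‖FourierTransform.fourier (fun v : ℝ => (v : ℂ) ^ k * G v ^ (m + 2)) x‖
        ≤ D / (1 + x ^ 2) := by
  have hG : Continuous G := continuous_iff_continuousAt.2 fun x => (h1 x).continuousAt
  have hG' : Continuous G' := continuous_iff_continuousAt.2 fun x => (h2 x).continuousAt
  have hM : 0 ≤ M := (norm_nonneg _).trans (b1 0)
  have hpow : ∀ (j : ℕ) (x : ℝ),
      HasDerivAt (fun v : ℝ => (v : ℂ) ^ j) (j * (x : ℂ) ^ (j - 1)) x := fun j x => by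
    simpa using (hasDerivAt_pow j (x : ℂ)).comp_ofReal
  have hGpow : ∀ (j : ℕ) (x : ℝ), HasDerivAt (fun v => G v ^ j) (j * G x ^ (j - 1) * G' x) x :=
    fun j x => (h1 x).fun_pow j
  -- Two differentiations use up at most two factors, so every term keeps `G ^ m`. Its decay of
  -- order -4 absorbs the weight of degree at most 2 and leaves the integrable order -2.
  have hH : ∀ x, HasDerivAt (fun v => G v ^ (m + 2)) ((m + 2 : ℕ) * G x ^ (m + 1) * G' x) x :=
    fun x => hGpow (m + 2) x
  have hH' : ∀ x, HasDerivAt (fun v => (m + 2 : ℕ) * G v ^ (m + 1) * G' v)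
      ((m + 2 : ℕ) * ((m + 1 : ℕ) * G x ^ m * G' x) * G' x
        + (m + 2 : ℕ) * G x ^ (m + 1) * G'' x) x :=
    fun x => (((hGpow (m + 1) x).const_mul _).mul (h2 x))
  -- Wherever an exponent is truncated at 0, its coefficient `k` or `k - 1` vanishes.
  have hpow' : ∀ (x : ℝ), HasDerivAt (fun v : ℝ => (k : ℂ) * (v : ℂ) ^ (k - 1))
      (k * ((k - 1 : ℕ) * (x : ℂ) ^ (k - 1 - 1))) x := fun x => (hpow (k - 1) x).const_mul _
  -- bounds on the power and its derivatives
  set A : ℝ := 1 + (m + 2) * M + ((m + 2) * (m + 1) * M * M + (m + 2) * M) with hA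
  have hA0 : 0 ≤ A := by positivity
  have g1 : ∀ x, ‖G x‖ ^ (m + 1) ≤ ‖G x‖ ^ m := fun x =>
    pow_le_pow_of_le_one (norm_nonneg _) (b0 x) (by omega)
  have g2 : ∀ x, ‖G x‖ ^ (m + 2) ≤ ‖G x‖ ^ m := fun x =>
    pow_le_pow_of_le_one (norm_nonneg _) (b0 x) (by omega)
  have n0 : ∀ x, ‖G x ^ (m + 2)‖ ≤ A * ‖G x‖ ^ m := fun x => by
    rw [norm_pow]
    refine (g2 x).trans (le_mul_of_one_le_left (by positivity) ?_)
    rw [hA]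
    have : 0 ≤ (m + 2) * M + ((m + 2) * (m + 1) * M * M + (m + 2) * M) := by positivity
    linarith
  have n1' : ∀ x, ‖((m + 2 : ℕ) : ℂ) * G x ^ (m + 1) * G' x‖ ≤ (m + 2) * M * ‖G x‖ ^ m :=
    fun x => by
    rw [norm_mul, norm_mul, norm_pow, Complex.norm_natCast]
    push_cast
    calc ((m : ℝ) + 2) * ‖G x‖ ^ (m + 1) * ‖G' x‖ ≤ (m + 2) * ‖G x‖ ^ m * M := by
          gcongr ?_ * ?_ * ?_
          · exact g1 x
          · exact b1 x
      _ = _ := by ring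
  have n1 : ∀ x, ‖((m + 2 : ℕ) : ℂ) * G x ^ (m + 1) * G' x‖ ≤ A * ‖G x‖ ^ m := fun x => by
    refine (n1' x).trans (mul_le_mul_of_nonneg_right ?_ (by positivity))
    have : 0 ≤ 1 + ((m + 2) * (m + 1) * M * M + (m + 2) * M) := by positivity
    linarith
  have n2 : ∀ x, ‖((m + 2 : ℕ) : ℂ) * ((m + 1 : ℕ) * G x ^ m * G' x) * G' x
      + (m + 2 : ℕ) * G x ^ (m + 1) * G'' x‖ ≤ A * ‖G x‖ ^ m := fun x => by
    refine (norm_add_le _ _).trans ?_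
    simp only [norm_mul, norm_pow, Complex.norm_natCast]
    push_cast
    have e1 : ((m : ℝ) + 2) * ((m + 1) * ‖G x‖ ^ m * ‖G' x‖) * ‖G' x‖ ≤
        (m + 2) * ((m + 1) * ‖G x‖ ^ m * M) * M := by
      gcongr ?_ * (?_ * ?_) * ?_
      · exact b1 x
      · exact b1 x
    have e2 : ((m : ℝ) + 2) * ‖G x‖ ^ (m + 1) * ‖G'' x‖ ≤ (m + 2) * ‖G x‖ ^ m * M := by
      gcongr ?_ * ?_ * ?_
      · exact g1 x
      · exact b2 x
    have e3 : 0 ≤ (1 + (m + 2) * M) * ‖G x‖ ^ m := by positivity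
    rw [hA]
    linarith
  -- integrability of the products
  have key : ∀ x, (1 + |x|) ^ 2 * ‖G x‖ ^ m ≤ C * (1 + |x|) ^ (-2 : ℝ) := fun x => by
    have hp : 0 < 1 + |x| := by positivity
    calc (1 + |x|) ^ 2 * ‖G x‖ ^ m ≤ (1 + |x|) ^ 2 * (C * (1 + |x|) ^ (-4 : ℝ)) := by
          gcongr; exact hm x
      _ = C * ((1 + |x|) ^ (2 : ℝ) * (1 + |x|) ^ (-4 : ℝ)) := by
          rw [Real.rpow_two]; ring
      _ = _ := by rw [← Real.rpow_add hp]; norm_num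
  have prod : ∀ {c : ℝ} (a : ℂ) (j : ℕ) (u : ℝ → ℂ), ‖a‖ ≤ c → j ≤ 2 →
      (∀ x, ‖u x‖ ≤ A * ‖G x‖ ^ m) → ∀ x : ℝ, ‖a * (x : ℂ) ^ j * u x‖ ≤
        c * A * C * (1 + |x|) ^ (-2 : ℝ) := by
    intro c a j u ha hj hu x
    have hc0 : 0 ≤ c := (norm_nonneg _).trans ha
    rw [norm_mul, norm_mul]
    calc ‖a‖ * ‖(x : ℂ) ^ j‖ * ‖u x‖ ≤ c * (1 + |x|) ^ 2 * (A * ‖G x‖ ^ m) := by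
          gcongr ?_ * ?_ * ?_
          · exact norm_ofReal_pow_le hj x
          · exact hu x
      _ = c * A * ((1 + |x|) ^ 2 * ‖G x‖ ^ m) := by ring
      _ ≤ c * A * (C * (1 + |x|) ^ (-2 : ℝ)) := by gcongr ?_ * ?_; exact key x
      _ = _ := by ring
  have iprod : ∀ (a : ℂ) (j : ℕ) (u : ℝ → ℂ), Continuous u → j ≤ 2 →
      (∀ x, ‖u x‖ ≤ A * ‖G x‖ ^ m) → Integrable fun x : ℝ => a * (x : ℂ) ^ j * u x := by
    intro a j u hu hj hb
    exact integrable_of_norm_le_rpow (by fun_prop) (prod a j u le_rfl hj hb)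
  have i0 : Integrable (fun v : ℝ => (v : ℂ) ^ k * G v ^ (m + 2)) := by
    simpa using iprod 1 k _ (by fun_prop) hk n0
  refine ⟨i0, exists_norm_fourier_le (fun x => (hpow k x).mul (hH x))
    (fun x => ((hpow' x).mul (hH x)).add ((hpow k x).mul (hH' x))) i0 ?_ ?_⟩
  · refine (iprod k (k - 1) _ (by fun_prop) (by omega) n0).add ?_
    simpa using iprod 1 k _ (by fun_prop) hk n1
  · have j0 : Integrable fun x : ℝ =>
        (k : ℂ) * ((k - 1 : ℕ) * (x : ℂ) ^ (k - 1 - 1)) * G x ^ (m + 2) := by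
      simpa [mul_assoc] using
        iprod ((k : ℂ) * (k - 1 : ℕ)) (k - 1 - 1) _ (by fun_prop) (by omega) n0
    refine (j0.add (iprod k (k - 1) _ (by fun_prop) (by omega) n1)).add
      ((iprod k (k - 1) _ (by fun_prop) (by omega) n1).add ?_)
    simpa using iprod 1 k _ (by fun_prop) hk n2

/-! ### Recovering a density from its transform -/

/-- A continuous integrable function whose Fourier transform is the characteristic function of a
probability measure is a density of that measure. -/
theorem isDensity_re_of_charFun_eq {ν : Measure ℝ} [IsProbabilityMeasure ν] {q : ℝ → ℂ}
    (hq : Continuous q) (hi : Integrable q)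
    (h : ∀ t : ℝ, charFun ν t = ∫ x : ℝ, Complex.exp (t * x * Complex.I) * q x) :
    IsDensity (fun x => (q x).re) ν := by
  set r : ℝ → ℝ := fun x => (q x).re with hrdef
  have hrc : Continuous r := by fun_prop
  have hri : Integrable r := hi.re
  -- Since f(-t) is the conjugate of f(t), q and its conjugate have the same transform; their
  -- average is Re q.
  have hr : ∀ t : ℝ, charFun ν t = ∫ x : ℝ, Complex.exp (t * x * Complex.I) * (r x : ℂ) := by
    intro t
    have hconj : charFun ν t =
        ∫ x : ℝ, Complex.exp (t * x * Complex.I) * (starRingEnd ℂ) (q x) := by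
      have h1 : charFun ν t = (starRingEnd ℂ) (charFun ν (-t)) := by simp
      rw [h1, h, ← integral_conj]
      refine integral_congr_ae (Eventually.of_forall fun x => ?_)
      simp [← Complex.exp_conj]
    have i1 := integrable_exp_mul hi t
    have i2 : Integrable fun x : ℝ =>
        Complex.exp (t * x * Complex.I) * (starRingEnd ℂ) (q x) :=
      integrable_exp_mul (p := fun x => (starRingEnd ℂ) (q x))
        ((Complex.conjLIE.integrable_comp_iff (μ := volume)).2 hi) t
    have h2 : charFun ν t + charFun ν t =
        2 * ∫ x : ℝ, Complex.exp (t * x * Complex.I) * (r x : ℂ) := by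
      nth_rewrite 1 [h t]
      rw [hconj, ← integral_add i1 i2, ← integral_const_mul]
      refine integral_congr_ae (Eventually.of_forall fun x => ?_)
      simp only [hrdef, ← mul_add, Complex.add_conj]
      push_cast
      ring
    linear_combination h2 / 2
  have dens : ∀ u : ℝ → ℝ, Continuous u → IsDensity (fun x => max (u x) 0)
      (volume.withDensity fun x => ENNReal.ofReal (u x)) := fun u hu =>
    ⟨by fun_prop, fun x => le_max_right _ _, by simp⟩
  -- The sign of r is unknown, so r is split into positive and negative parts: ν + r⁻dx and r⁺dx are
  -- finite measures with equal characteristic functions. As r⁺dx does not charge {r < 0}, neither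
  -- does r⁻dx.
  set mp := volume.withDensity fun x => ENNReal.ofReal (r x) with hmp
  set mn := volume.withDensity fun x => ENNReal.ofReal (-r x) with hmn
  have : IsFiniteMeasure mp := isFiniteMeasure_withDensity_ofReal hri.2
  have : IsFiniteMeasure mn := isFiniteMeasure_withDensity_ofReal hri.neg.2
  have heq : ν + mn = mp := by
    refine Measure.ext_of_charFun (funext fun t => ?_)
    have d1 := dens r hrc
    have d2 := dens (fun x => -r x) hrc.neg
    have hadd : charFun (ν + mn) t = charFun ν t + charFun mn t := by
      have b : ∀ κ : Measure ℝ, IsFiniteMeasure κ →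
          Integrable (fun x : ℝ => Complex.exp (t * x * Complex.I)) κ := fun κ _ =>
        (integrable_const (1 : ℝ)).mono' (Continuous.aestronglyMeasurable (by fun_prop))
          (Eventually.of_forall fun x => (norm_exp_mul_mul_I t x).le)
      simp only [charFun_apply_real]
      exact integral_add_measure (b ν inferInstance) (b mn inferInstance)
    rw [hadd, hr, d1.charFun_eq, d2.charFun_eq]
    have i1 : Integrable fun x : ℝ => Complex.exp (t * x * Complex.I) * (r x : ℂ) :=
      integrable_exp_mul hri.ofReal t
    have i2 : Integrable fun x : ℝ =>
        Complex.exp (t * x * Complex.I) * ((max (-r x) 0 : ℝ) : ℂ) :=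
      integrable_exp_mul hri.neg.pos_part.ofReal t
    rw [← integral_add i1 i2]
    refine integral_congr_ae (Eventually.of_forall fun x => ?_)
    simp only
    rw [← mul_add, ← Complex.ofReal_add]
    congr 2
    rcases le_total 0 (r x) with h0 | h0
    · rw [max_eq_left h0, max_eq_right (by linarith), add_zero]
    · rw [max_eq_right h0, max_eq_left (by linarith), add_neg_cancel]
  have hS : MeasurableSet {x | r x < 0} := (isOpen_lt hrc continuous_const).measurableSet
  have hmnS : mn {x | r x < 0} = 0 := by
    have hp0 : mp {x | r x < 0} = 0 := by
      rw [hmp, withDensity_apply _ hS, setLIntegral_eq_zero_iff hS (by fun_prop)]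
      exact Eventually.of_forall fun x hx => ENNReal.ofReal_of_nonpos (le_of_lt hx)
    have := congrArg (fun κ : Measure ℝ => κ {x | r x < 0}) heq
    simp only [Measure.add_apply, hp0] at this
    exact (add_eq_zero.1 this).2
  have hr0 : ∀ x, 0 ≤ r x := by
    have hv : volume {x | r x < 0} = 0 := by
      rw [hmn, withDensity_apply _ hS, setLIntegral_eq_zero_iff hS (by fun_prop)] at hmnS
      refine measure_mono_null (fun x (hx : r x < 0) => ?_) hmnS
      simpa using hx
    -- An open null set is empty, so r ≥ 0 everywhere and not merely almost everywhere.
    have he := (isOpen_lt hrc continuous_const).measure_eq_zero_iff volume |>.1 hv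
    intro x
    by_contra hx
    have : x ∈ {x | r x < 0} := not_le.1 hx
    rw [he] at this
    exact this
  refine ⟨hrc.measurable, hr0, ?_⟩
  have : mn = 0 := by
    rw [hmn]
    have : (fun x => ENNReal.ofReal (-r x)) = 0 :=
      funext fun x => ENNReal.ofReal_of_nonpos (by linarith [hr0 x])
    rw [this, withDensity_zero]
  rw [← hmp, ← heq, this, add_zero]

/-! ### Finiteness of the Fisher information -/

/-- A nonnegative function with quadratically decaying derivatives satisfies a pointwise
Landau-type inequality. -/
theorem sq_deriv_le_of_nonneg {p q r : ℝ → ℝ} (h0 : ∀ x, 0 ≤ p x)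
    (h1 : ∀ x, HasDerivAt p (q x) x) (h2 : ∀ x, HasDerivAt q (r x) x) {D : ℝ} (hD : 0 < D)
    (bq : ∀ x, |q x| ≤ D / (1 + x ^ 2)) (br : ∀ x, |r x| ≤ D / (1 + x ^ 2)) (x : ℝ) :
    q x ^ 2 ≤ 4 * (3 * D / (1 + x ^ 2)) * p x := by
  -- The factor 3 comes from 1 + x² ≤ 3(1 + y²) for |y - x| ≤ 1, so M bounds |r| on that whole
  -- neighbourhood.
  set M := 3 * D / (1 + x ^ 2) with hM
  have hM0 : 0 < M := by positivity
  have hqM : |q x| ≤ M := (bq x).trans (by rw [hM]; gcongr; linarith)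
  have hrM : ∀ y, |y - x| ≤ 1 → |r y| ≤ M := by
    intro y hy
    refine (br y).trans ?_
    rw [hM, div_le_div_iff₀ (by positivity) (by positivity)]
    have : 1 + x ^ 2 ≤ 3 * (1 + y ^ 2) := by
      have := abs_le.1 hy
      nlinarith [sq_nonneg (y + (y - x))]
    nlinarith
  -- The minimizer of p(x) + q(x)s + Ms², which dominates p(x+s) ≥ 0 for |s| ≤ 1; the minimum is
  -- p(x) - q(x)²/(4M).
  set s := -q x / (2 * M) with hs
  have hs1 : |s| ≤ 1 := by
    rw [hs, abs_div, abs_neg, abs_of_pos (by positivity : 0 < 2 * M),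
      div_le_one (by positivity)]
    linarith
  have hball : ∀ y ∈ Set.uIcc x (x + s), |y - x| ≤ |s| := fun y hy => by
    simpa using Set.abs_sub_left_of_mem_uIcc hy
  have hq : ∀ y ∈ Set.uIcc x (x + s), |q y - q x| ≤ M * |s| := by
    intro y hy
    refine ((convex_uIcc x (x + s)).norm_image_sub_le_of_norm_hasDerivWithin_le
      (fun z _ => (h2 z).hasDerivWithinAt) (fun z hz => hrM z ((hball z hz).trans hs1))
      Set.left_mem_uIcc hy).trans ?_
    exact mul_le_mul_of_nonneg_left (hball y hy) hM0.le
  have hp : |(p (x + s) - q x * (x + s)) - (p x - q x * x)| ≤ M * |s| * |s| := by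
    have := (convex_uIcc x (x + s)).norm_image_sub_le_of_norm_hasDerivWithin_le
      (f := fun y => p y - q x * y) (f' := fun y => q y - q x)
      (fun z _ => ((h1 z).sub ((hasDerivAt_id z).const_mul (q x) |>.congr_deriv
        (mul_one _))).hasDerivWithinAt) hq Set.left_mem_uIcc Set.right_mem_uIcc
    simpa using this
  have h3 := (abs_le.1 hp).2
  have h4 := h0 (x + s)
  have h5 : M * |s| * |s| = M * s ^ 2 := by rw [mul_assoc, abs_mul_abs_self]; ring
  have h6 : 0 ≤ p x + q x * s + M * s ^ 2 := by linarith
  have h7 : p x + q x * s + M * s ^ 2 = p x - q x ^ 2 / (4 * M) := by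
    rw [hs]; field_simp; ring
  rw [h7, sub_nonneg, div_le_iff₀ (by positivity)] at h6
  linarith

theorem fisherIntegral_lt_top {p q r : ℝ → ℝ} (h0 : ∀ x, 0 ≤ p x)
    (h1 : ∀ x, HasDerivAt p (q x) x) (h2 : ∀ x, HasDerivAt q (r x) x) {D : ℝ} (hD : 0 < D)
    (bq : ∀ x, |q x| ≤ D / (1 + x ^ 2)) (br : ∀ x, |r x| ≤ D / (1 + x ^ 2)) :
    fisherIntegral p < ∞ := by
  have hI : Integrable fun x : ℝ => 4 * (3 * D) * (1 + x ^ 2)⁻¹ :=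
    integrable_inv_one_add_sq.const_mul _
  refine lt_of_le_of_lt ?_ hI.lintegral_lt_top
  have hpc : Continuous p := continuous_iff_continuousAt.2 fun x => (h1 x).continuousAt
  refine (setLIntegral_mono' (isOpen_lt continuous_const hpc).measurableSet
    fun x (hx : 0 < p x) => ?_).trans (setLIntegral_le_lintegral {x | 0 < p x} _)
  refine ENNReal.ofReal_le_ofReal ?_
  rw [(h1 x).deriv, div_le_iff₀ hx]
  refine (sq_deriv_le_of_nonneg h0 h1 h2 hD bq br x).trans_eq ?_
  rw [div_eq_mul_inv]; ring

/-! ### Smooth densities of normalized sums -/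

theorem fourier_const_mul (a : ℂ) (f : ℝ → ℂ) (x : ℝ) :
    FourierTransform.fourier (fun v => a * f v) x = a * FourierTransform.fourier f x := by
  simp only [Real.fourier_real_eq, Circle.smul_def, smul_eq_mul, ← integral_const_mul]
  refine integral_congr_ae (Eventually.of_forall fun v => ?_)
  simp only
  ring

theorem hasDerivAt_fourier_pow_mul {H : ℝ → ℂ} {k : ℕ}
    (h1 : Integrable fun v : ℝ => (v : ℂ) ^ k * H v)
    (h2 : Integrable fun v : ℝ => (v : ℂ) ^ (k + 1) * H v) (x : ℝ) :
    HasDerivAt (FourierTransform.fourier fun v : ℝ => (v : ℂ) ^ k * H v)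
      ((-2 * Real.pi * Complex.I) *
        FourierTransform.fourier (fun v : ℝ => (v : ℂ) ^ (k + 1) * H v) x) x := by
  have e : (fun v : ℝ => v • ((v : ℂ) ^ k * H v)) = fun v : ℝ => (v : ℂ) ^ (k + 1) * H v := by
    funext v
    rw [Complex.real_smul]
    ring
  refine (Real.hasDerivAt_fourier h1 (e ▸ h2) x).congr_deriv ?_
  rw [← fourier_const_mul]
  refine congrArg (fun f : ℝ → ℂ => FourierTransform.fourier f x) (funext fun v => ?_)
  rw [smul_eq_mul]
  ring

theorem HasDerivAt.complex_re {f : ℝ → ℂ} {f' : ℂ} {x : ℝ} (h : HasDerivAt f f' x) :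
    HasDerivAt (fun y => (f y).re) f'.re x :=
  Complex.reCLM.hasFDerivAt.comp_hasDerivAt x h

/-- A measure whose characteristic function is a high power of a function with polynomial decay
and bounded derivatives has a twice differentiable density with quadratic decay. -/
theorem exists_density_of_charFun_eq_pow {ν : Measure ℝ} [IsProbabilityMeasure ν]
    {G G' G'' : ℝ → ℂ} (h1 : ∀ x, HasDerivAt G (G' x) x)
    (h2 : ∀ x, HasDerivAt G' (G'' x) x) (hc : Continuous G'') {M C : ℝ}
    (b0 : ∀ x, ‖G x‖ ≤ 1) (b1 : ∀ x, ‖G' x‖ ≤ M) (b2 : ∀ x, ‖G'' x‖ ≤ M) {m : ℕ}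
    (hm : ∀ x, ‖G x‖ ^ m ≤ C * (1 + |x|) ^ (-4 : ℝ))
    (hν : ∀ v, charFun ν (2 * Real.pi * v) = G v ^ (m + 2)) :
    ∃ p q r : ℝ → ℝ, IsDensity p ν ∧ (∀ x, HasDerivAt p (q x) x) ∧
      (∀ x, HasDerivAt q (r x) x) ∧ ∃ D : ℝ, 0 < D ∧ (∀ x, |q x| ≤ D / (1 + x ^ 2)) ∧
        ∀ x, |r x| ≤ D / (1 + x ^ 2) := by
  set F : ℕ → ℝ → ℂ := fun k => FourierTransform.fourier fun v : ℝ => (v : ℂ) ^ k * G v ^ (m + 2)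
    with hF
  have hG : Continuous G := continuous_iff_continuousAt.2 fun x => (h1 x).continuousAt
  obtain ⟨i0, D0, hD0⟩ := fourier_pow_mul_pow h1 h2 hc b0 b1 b2 hm (k := 0) (by norm_num)
  obtain ⟨i1, D1, hD1⟩ := fourier_pow_mul_pow h1 h2 hc b0 b1 b2 hm (k := 1) (by norm_num)
  obtain ⟨i2, D2, hD2⟩ := fourier_pow_mul_pow h1 h2 hc b0 b1 b2 hm (k := 2) (by norm_num)
  obtain ⟨a, ha⟩ : ∃ a : ℂ, a = -2 * Real.pi * Complex.I := ⟨_, rfl⟩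
  have d0 : ∀ x, HasDerivAt (F 0) (a * F 1 x) x :=
    ha ▸ hasDerivAt_fourier_pow_mul i0 i1
  have d1 : ∀ x, HasDerivAt (F 1) (a * F 2 x) x :=
    ha ▸ hasDerivAt_fourier_pow_mul i1 i2
  have hF0c : Continuous (F 0) := continuous_iff_continuousAt.2 fun x => (d0 x).continuousAt
  have hF0i : Integrable (F 0) :=
    (integrable_inv_one_add_sq.const_mul D0).mono' hF0c.aestronglyMeasurable
      (Eventually.of_forall hD0)
  have hinv := Continuous.fourierInv_fourier_eq
    (f := fun v : ℝ => (v : ℂ) ^ 0 * G v ^ (m + 2)) (by fun_prop) i0 hF0i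
  have hchar : ∀ t : ℝ, charFun ν t = ∫ x : ℝ, Complex.exp (t * x * Complex.I) * F 0 x := by
    intro t
    have hpi : (Real.pi : ℂ) ≠ 0 := by exact_mod_cast Real.pi_ne_zero
    -- The Fourier kernel is e^(2πivx), so inversion is evaluated at v = t/(2π).
    have ht : 2 * Real.pi * (t / (2 * Real.pi)) = t := by field_simp
    have := congrFun hinv (t / (2 * Real.pi))
    rw [pow_zero, one_mul, ← hν, ht] at this
    rw [← this, Real.fourierInv_eq']
    refine integral_congr_ae (Eventually.of_forall fun x => ?_)
    simp only [smul_eq_mul, hF]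
    congr 2
    simp only [RCLike.inner_apply, conj_trivial]
    push_cast
    field_simp
  refine ⟨fun x => (F 0 x).re, fun x => (a * F 1 x).re, fun x => (a * (a * F 2 x)).re,
    isDensity_re_of_charFun_eq hF0c hF0i hchar, fun x => (d0 x).complex_re,
    fun x => ((d1 x).const_mul a).complex_re,
    1 + ‖a‖ * |D1| + ‖a‖ * (‖a‖ * |D2|), by positivity, fun x => ?_, fun x => ?_⟩
  · refine (Complex.abs_re_le_norm _).trans ?_
    rw [norm_mul]
    calc ‖a‖ * ‖F 1 x‖ ≤ ‖a‖ * (|D1| / (1 + x ^ 2)) := by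
          gcongr
          exact (hD1 x).trans (by gcongr; exact le_abs_self _)
      _ = ‖a‖ * |D1| / (1 + x ^ 2) := by ring
      _ ≤ _ := by
          gcongr
          have : 0 ≤ ‖a‖ * (‖a‖ * |D2|) := by positivity
          linarith
  · refine (Complex.abs_re_le_norm _).trans ?_
    rw [norm_mul, norm_mul]
    calc ‖a‖ * (‖a‖ * ‖F 2 x‖) ≤ ‖a‖ * (‖a‖ * (|D2| / (1 + x ^ 2))) := by
          gcongr
          exact (hD2 x).trans (by gcongr; exact le_abs_self _)
      _ = ‖a‖ * (‖a‖ * |D2|) / (1 + x ^ 2) := by ring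
      _ ≤ _ := by
          gcongr
          have : 0 ≤ ‖a‖ * |D1| := by positivity
          linarith

/-- The law of Z_n enters only through its characteristic function. Taking n = m + 2 with mε ≥ 4
makes the m-th power of f₁ decay with order -4. -/
theorem exists_density_of_isBigO {μ : Measure ℝ} [IsProbabilityMeasure μ] (hm : MemLp id 2 μ)
    {ε : ℝ} (hε : 0 < ε)
    (h : (fun t : ℝ => ‖charFun μ t‖) =O[atTop] (fun t : ℝ => t ^ (-ε))) :
    ∃ n : ℕ, 1 ≤ n ∧ ∀ (ν : Measure ℝ) [IsProbabilityMeasure ν],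
      (∀ t, charFun ν t = charFun μ ((√(n : ℝ))⁻¹ * t) ^ n) →
      ∃ p q r : ℝ → ℝ, IsDensity p ν ∧ (∀ x, HasDerivAt p (q x) x) ∧
        (∀ x, HasDerivAt q (r x) x) ∧ ∃ D : ℝ, 0 < D ∧ (∀ x, |q x| ≤ D / (1 + x ^ 2)) ∧
          ∀ x, |r x| ≤ D / (1 + x ^ 2) := by
  obtain ⟨C, hC, hb⟩ := exists_norm_charFun_le_of_isBigO hε h
  obtain ⟨m, hmε⟩ := exists_nat_ge (4 / ε)
  rw [div_le_iff₀ hε] at hmε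
  refine ⟨m + 2, by omega, fun ν _ hν => ?_⟩
  -- c combines the normalization 1/√n with the 2π of the Fourier kernel.
  obtain ⟨c, hcdef⟩ : ∃ c : ℝ, c = (√((m + 2 : ℕ) : ℝ))⁻¹ * (2 * Real.pi) := ⟨_, rfl⟩
  have hc : 0 < c := by rw [hcdef]; positivity
  have hf : ContDiff ℝ 2 (charFun μ) := contDiff_charFun (n := 2) (by simpa using hm)
  have hm1 : MemLp id 1 μ := hm.mono_exponent (by norm_num)
  have hd : ∀ t, HasDerivAt (charFun μ) (deriv (charFun μ) t) t := fun t =>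
    (hf.differentiable (by norm_num) t).hasDerivAt
  have hf1 : ContDiff ℝ 1 (deriv (charFun μ)) :=
    ((contDiff_succ_iff_deriv (n := 1)).1 (by simpa [one_add_one_eq_two] using hf)).2.2
  have hd2 : ∀ t, HasDerivAt (deriv (charFun μ)) (deriv (deriv (charFun μ)) t) t := fun t =>
    (hf1.differentiable (by norm_num) t).hasDerivAt
  have hcont : Continuous (deriv (deriv (charFun μ))) := hf1.continuous_deriv (by norm_num)
  set M1 := ∫ x, |x| ^ 1 ∂μ
  set M2 := ∫ x, |x| ^ 2 ∂μ
  have hM1 : 0 ≤ M1 := integral_nonneg fun _ => by positivity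
  have hM2 : 0 ≤ M2 := integral_nonneg fun _ => by positivity
  have bd1 : ∀ t, ‖deriv (charFun μ) t‖ ≤ M1 := fun t => by
    have := norm_iteratedDeriv_charFun_le (n := 1) (by simpa using hm1) t
    rwa [iteratedDeriv_one] at this
  have bd2 : ∀ t, ‖deriv (deriv (charFun μ)) t‖ ≤ M2 := fun t => by
    have := norm_iteratedDeriv_charFun_le (n := 2) (by simpa using hm) t
    rwa [iteratedDeriv_succ, iteratedDeriv_one] at this
  have hlin : ∀ x : ℝ, HasDerivAt (fun v => c * v) c x := fun x => by
    simpa using (hasDerivAt_id x).const_mul c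
  have hdecay : ∀ x : ℝ, ‖charFun μ (c * x)‖ ^ m ≤
      (C * (min 1 c) ^ (-ε)) ^ m * (1 + |x|) ^ (-4 : ℝ) := by
    intro x
    have hmin : 0 < min 1 c := lt_min one_pos hc
    have hx : 0 < 1 + |x| := by positivity
    have hle : min 1 c * (1 + |x|) ≤ 1 + |c * x| := by
      rw [abs_mul, abs_of_pos hc, mul_add, mul_one]
      exact add_le_add (min_le_left _ _)
        (mul_le_mul_of_nonneg_right (min_le_right _ _) (abs_nonneg _))
    have h3 : ‖charFun μ (c * x)‖ ≤ C * (min 1 c) ^ (-ε) * (1 + |x|) ^ (-ε) := by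
      refine (hb _).trans ?_
      rw [mul_assoc, ← Real.mul_rpow hmin.le hx.le]
      exact mul_le_mul_of_nonneg_left
        (Real.rpow_le_rpow_of_nonpos (by positivity) hle (by linarith)) hC.le
    calc ‖charFun μ (c * x)‖ ^ m ≤ (C * (min 1 c) ^ (-ε) * (1 + |x|) ^ (-ε)) ^ m := by gcongr
      _ = (C * (min 1 c) ^ (-ε)) ^ m * (1 + |x|) ^ (-ε * m) := by
          rw [mul_pow, Real.rpow_mul_natCast hx.le]
      _ ≤ _ := by
          gcongr
          · linarith [abs_nonneg x]
          · linarith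
  refine exists_density_of_charFun_eq_pow (G := fun v => charFun μ (c * v))
    (G' := fun v => c * deriv (charFun μ) (c * v))
    (G'' := fun v => c * (c * deriv (deriv (charFun μ)) (c * v)))
    (M := c * M1 + c * (c * M2)) (m := m) (fun x => ?_) (fun x => ?_) (by fun_prop)
    (fun x => norm_charFun_le_one _) (fun x => ?_) (fun x => ?_) hdecay (fun v => ?_)
  · exact (HasDerivAt.scomp x (hd (c * x)) (hlin x)).congr_deriv (Complex.real_smul ..)
  · exact ((HasDerivAt.scomp x (hd2 (c * x)) (hlin x)).congr_deriv
      (Complex.real_smul ..)).const_mul (c : ℂ)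
  · rw [norm_mul, Complex.norm_real, Real.norm_of_nonneg hc.le]
    have : c * ‖deriv (charFun μ) (c * x)‖ ≤ c * M1 := by gcongr; exact bd1 _
    have : 0 ≤ c * (c * M2) := by positivity
    linarith
  · rw [norm_mul, norm_mul, Complex.norm_real, Real.norm_of_nonneg hc.le]
    have : c * (c * ‖deriv (deriv (charFun μ)) (c * x)‖) ≤ c * (c * M2) := by
      gcongr; exact bd2 _
    have : 0 ≤ c * M1 := by positivity
    linarith
  · rw [hν, hcdef]
    simp only [mul_assoc]

/-- Replace t by √n·t and take the n-th root. -/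
theorem isBigO_charFun_of_pow_le {μ : Measure ℝ} {n : ℕ} (hn : 1 ≤ n) {K : ℝ} (hK : 0 ≤ K)
    (h : ∀ t : ℝ, 0 < t → ‖charFun μ ((√(n : ℝ))⁻¹ * t)‖ ^ n ≤ K / t) :
    (fun t : ℝ => ‖charFun μ t‖) =O[atTop] (fun t : ℝ => t ^ (-(1 / (n : ℝ)))) := by
  have hn0 : (0 : ℝ) < n := by exact_mod_cast hn
  have hs : 0 < √(n : ℝ) := Real.sqrt_pos.2 hn0
  refine Asymptotics.IsBigO.of_bound ((K / √(n : ℝ)) ^ (1 / (n : ℝ))) ?_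
  filter_upwards [eventually_gt_atTop 0] with t ht
  have h1 := h (√(n : ℝ) * t) (by positivity)
  rw [inv_mul_cancel_left₀ hs.ne'] at h1
  rw [norm_norm, Real.norm_of_nonneg (by positivity), Real.rpow_neg ht.le,
    ← Real.inv_rpow ht.le, ← Real.mul_rpow (by positivity) (by positivity)]
  calc ‖charFun μ t‖ = (‖charFun μ t‖ ^ n) ^ (1 / (n : ℝ)) := by
        rw [one_div, Real.pow_rpow_inv_natCast (norm_nonneg _) (by omega)]
    _ ≤ _ := by
        refine Real.rpow_le_rpow (by positivity) (h1.trans_eq ?_) (by positivity)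
        rw [← div_div, div_eq_mul_inv _ t]

/-! ### The equivalences -/

theorem theorem1p3 {Ω : Type*} [MeasurableSpace Ω] (P : Measure Ω) [IsProbabilityMeasure P]
    (X : ℕ → Ω → ℝ) (hindep : iIndepFun X P) (hident : ∀ i, IdentDistrib (X i) (X 0) P P)
    (hmom : MemLp (X 0) 2 P) :
    List.TFAE [
      ∃ n : ℕ, 1 ≤ n ∧ fisherInfo (P.map (normalizedSum X n)) < ∞,
      ∃ n : ℕ, 1 ≤ n ∧ ∃ p : ℝ → ℝ, IsDensity p (P.map (normalizedSum X n)) ∧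
        BoundedVariationOn p Set.univ,
      ∃ n : ℕ, 1 ≤ n ∧ ∃ p : ℝ → ℝ, IsDensity p (P.map (normalizedSum X n)) ∧
        ContDiff ℝ 1 p ∧ Integrable (deriv p) volume,
      ∃ ε : ℝ, 0 < ε ∧
        (fun t : ℝ => ‖charFun (P.map (X 0)) t‖) =O[atTop] (fun t : ℝ => t ^ (-ε)),
      ∃ ν : ℝ, 0 < ν ∧
        Integrable (fun t : ℝ => ‖charFun (P.map (X 0)) t‖ ^ ν * |t|) volume] := by
  have hX : ∀ i, AEMeasurable (X i) P := fun i => (hident i).aemeasurable_fst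
  have hZ : ∀ n, AEMeasurable (normalizedSum X n) P := fun n =>
    (Finset.aemeasurable_fun_sum _ fun i _ => hX i).div_const _
  have : IsProbabilityMeasure (P.map (X 0)) := Measure.isProbabilityMeasure_map (hX 0)
  have hprob : ∀ n, IsProbabilityMeasure (P.map (normalizedSum X n)) := fun n =>
    Measure.isProbabilityMeasure_map (hZ n)
  have hm2 : MemLp id 2 (P.map (X 0)) :=
    (memLp_map_measure_iff aestronglyMeasurable_id (hX 0)).2 hmom
  have hchar : ∀ n t, charFun (P.map (normalizedSum X n)) t =
      charFun (P.map (X 0)) ((√(n : ℝ))⁻¹ * t) ^ n := fun n t => by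
    rw [← charFun_inv_sqrt_mul_sum hindep hident]
    congr 2
    funext ω
    rw [normalizedSum, div_eq_inv_mul]
  tfae_have 1 → 2 := by
    rintro ⟨n, hn, h⟩
    simp only [fisherInfo, iInf_lt_iff] at h
    obtain ⟨p, hp, hac, hI⟩ := h
    exact ⟨n, hn, p, hp, hac.boundedVariationOn (hp.integrable_deriv hI)⟩
  tfae_have 3 → 2 := by
    rintro ⟨n, hn, p, hp, hC, hI⟩
    exact ⟨n, hn, p, hp, (isAbsCont_of_contDiff hC).boundedVariationOn hI⟩
  tfae_have 2 → 4 := by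
    rintro ⟨n, hn, p, hp, hV⟩
    refine ⟨1 / n, by positivity, isBigO_charFun_of_pow_le hn
      (K := (eVariationOn p Set.univ).toReal * Real.pi) (by positivity) fun t ht => ?_⟩
    rw [← norm_pow, ← hchar]
    exact hp.norm_charFun_le hV ht
  tfae_have 4 → 5 := fun ⟨ε, hε, h⟩ => exists_integrable_rpow_charFun hε h
  tfae_have 5 → 4 := fun ⟨ν, hν, h⟩ =>
    exists_isBigO_of_integrable_rpow_charFun (hm2.mono_exponent (by norm_num)) hν h
  tfae_have 4 → 3 := by
    rintro ⟨ε, hε, h⟩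
    obtain ⟨n, hn, hex⟩ := exists_density_of_isBigO hm2 hε h
    obtain ⟨p, q, r, hp, h1, h2, D, hD, bq, br⟩ := hex _ (hchar n)
    have hd : deriv p = q := funext fun x => (h1 x).deriv
    have hqc : Continuous q := continuous_iff_continuousAt.2 fun x => (h2 x).continuousAt
    refine ⟨n, hn, p, hp, contDiff_one_iff_deriv.2
      ⟨fun x => (h1 x).differentiableAt, hd ▸ hqc⟩, ?_⟩
    rw [hd]
    exact (integrable_inv_one_add_sq.const_mul D).mono' hqc.aestronglyMeasurable
      (Eventually.of_forall bq)
  tfae_have 4 → 1 := by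
    rintro ⟨ε, hε, h⟩
    obtain ⟨n, hn, hex⟩ := exists_density_of_isBigO hm2 hε h
    obtain ⟨p, q, r, hp, h1, h2, D, hD, bq, br⟩ := hex _ (hchar n)
    have hd : deriv p = q := funext fun x => (h1 x).deriv
    have hqc : Continuous q := continuous_iff_continuousAt.2 fun x => (h2 x).continuousAt
    have hac : IsAbsCont p := isAbsCont_of_contDiff
      (contDiff_one_iff_deriv.2 ⟨fun x => (h1 x).differentiableAt, hd ▸ hqc⟩)
    exact ⟨n, hn, (iInf_le_of_le p (iInf₂_le hp hac)).trans_lt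
      (fisherIntegral_lt_top hp.nonneg h1 h2 hD bq br)⟩
  tfae_finish
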